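/- Let $X\subset\mathbb R$ be a countable set of alternatives and let $N$ be a finite non-empty set of agents partitioned into $A$ and $D=N\setminus A$ (either of which may be empty). A preference is a complete, transitive and antisymmetric relation $R_i$ on $X$, with strict part $P_i$. It is single-peaked if there is a peak $\rho\in X$ such that $x\,P_i\,y$ whenever $x,y\in X$ and $\rho\ge x>y$ or $\rho\le x<y$; it is single-dipped if there is a dip $\delta\in X$ such that $y\,P_i\,x$ whenever $x,y\in X$ and $\delta\ge x>y$ or $\delta\le x<y$. Let $\mathcal R$ be the set of all profiles $R=(R_i)_{i\in N}$ such that $R_i$ is single-peaked for $i\in A$ and single-dipped for $i\in D$. A rule is a function $f:\mathcal R\to X$; $\Omega=f(\mathcal R)$ denotes its range. The rule is strategy-proof (SP) if there are no $i\in N$ and $R,R'\in\mathcal R$ with $R'_j=R_j$ for all $j\ne i$ and $f(R')\,P_i\,f(R)$. It is Pareto efficient (PE) if there are no $R\in\mathcal R$ and $x\in X$ such that $x\,P_i\,f(R)$ for all $i\in N$. For $p=(p_i)_{i\in A}\in\Omega^A$ let $\Omega(p)$ be the set of all $f(R)$ with $R\in\mathcal R$ such that, for each $i\in A$, $p_i\,P_i\,y$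 for all $y\in\Omega\setminus\{p_i\}$. For SP rules $\Omega(p)$ has at most two elements; let $\omega(p)=\Omega(p)$, where a two-element set $\{x,y\}$ with $x<y$ is written as the pair $(x,y)$, and let $r_\omega=\{\omega(p):p\in\Omega^A\}$. Then the following statements hold. (i) Every SP rule with $\Omega=X$ is PE. (ii) Every SP rule such that $\Omega\ne X$, and such that it is not the case that $\min X$ and $\max X$ exist and $\Omega=\{\min X,\max X\}$, is not PE. (iii) If $\min X$ and $\max X$ exist, then an SP rule with $\Omega=\{\min X,\max X\}\ne X$ is PE if and only if $A=\emptyset$ or $r_\omega=\{(\min X,\max X)\}$. -/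

import Mathlib

namespace PublicFacility

/-- A preference over the set of alternatives `X ⊆ ℝ`: a complete, transitive and
antisymmetric binary relation (`rel x y` reads "`x` is at least as good as `y`"). -/
structure Pref (X : Set ℝ) where
  rel : X → X → Prop
  complete : ∀ x y, rel x y ∨ rel y x
  transitive : ∀ x y z, rel x y → rel y z → rel x z
  antisymmetric : ∀ x y, rel x y → rel y x → x = y

/-- The strict preference induced by `R`. -/
def Pref.strict {X : Set ℝ} (R : Pref X) (x y : X) : Prop :=
  R.rel x y ∧ ¬ R.rel y x

/-- `ρ` is a peak of `R`: the preference strictly improves towards `ρ` on each side of `ρ`. -/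
def Pref.IsPeak {X : Set ℝ} (R : Pref X) (ρ : X) : Prop :=
  ∀ x y : X, (ρ ≥ x ∧ x > y) ∨ (ρ ≤ x ∧ x < y) → R.strict x y

/-- `δ` is a dip of `R`: the preference strictly worsens towards `δ` on each side of `δ`. -/
def Pref.IsDip {X : Set ℝ} (R : Pref X) (δ : X) : Prop :=
  ∀ x y : X, (δ ≥ x ∧ x > y) ∨ (δ ≤ x ∧ x < y) → R.strict y x

def Pref.SinglePeaked {X : Set ℝ} (R : Pref X) : Prop := ∃ ρ, R.IsPeak ρ

def Pref.SingleDipped {X : Set ℝ} (R : Pref X) : Prop := ∃ δ, R.IsDip δ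

/-- The admissible preferences of agent `i`: all single-peaked preferences if `i ∈ A`, all
single-dipped preferences if `i ∈ D`, where `D` is the complement of `A`. -/
def Admissible {N : Type*} (X : Set ℝ) (A : Set N) (i : N) : Set (Pref X) :=
  {R | (i ∈ A → R.SinglePeaked) ∧ (i ∉ A → R.SingleDipped)}

/-- Preference profiles. -/
abbrev Profile {N : Type*} (X : Set ℝ) (A : Set N) : Type _ :=
  (i : N) → Admissible X A i

/-- Social choice rules. -/
abbrev Rule {N : Type*} (X : Set ℝ) (A : Set N) : Type _ :=
  Profile X A → X

section Axioms

variable {N : Type*} {X : Set ℝ} {A : Set N}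

/-- `f` is manipulable by the group `S`: at some profile `R` the members of `S` can change their
reported preferences, those of all other agents staying the same, so that every member of `S` is
strictly better off according to the preference in `R`. -/
def ManipulableBy (f : Rule X A) (S : Set N) : Prop :=
  ∃ R R' : Profile X A, (∀ i, i ∉ S → R' i = R i) ∧ ∀ i ∈ S, (R i).1.strict (f R') (f R)

/-- Strategy-proofness: no group of size one can manipulate. -/
def StrategyProof (f : Rule X A) : Prop :=
  ∀ S : Set N, S.ncard = 1 → ¬ ManipulableBy f S

/-- Pareto efficiency. -/
def ParetoEfficient (f : Rule X A) : Prop :=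
  ∀ R : Profile X A, ¬ ∃ x : X, ∀ i : N, (R i).1.strict x (f R)

/-- The range `Ω` of a rule. -/
def Omega (f : Rule X A) : Set X :=
  {x | ∃ R : Profile X A, f R = x}

/-- `x` is the `Ω`-restricted peak of `R`: the best alternative of the range. -/
def IsRestrictedPeak (Ω : Set X) (R : Pref X) (x : X) : Prop :=
  x ∈ Ω ∧ ∀ y ∈ Ω \ {x}, R.strict x y

/-- `Ω(p)`: the alternatives chosen by `f` at the profiles in which the vector of `Ω`-restricted
peaks of the agents of `A` is `p`. -/
def OmegaAt (f : Rule X A) (p : A → Omega f) : Set X :=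
  {x | ∃ R : Profile X A,
    (∀ i : A, IsRestrictedPeak (Omega f) (R i).1 (p i).1) ∧ f R = x}

/-- The range `r_ω` of the first-step function `ω`, which maps each vector of restricted peaks
`p ∈ Ω^a` to the set `ω(p) = Ω(p)` of preselected alternatives. A preselected pair `(x, y)` is
represented by the set `{x, y}`, a single preselected alternative `x` by the set `{x}`. -/
def rOmega (f : Rule X A) : Set (Set X) :=
  {s | ∃ p : A → Omega f, OmegaAt f p = s}

end Axioms

end PublicFacility

namespace PublicFacility

open scoped Classical
-- On this domain individual strategy-proofness implies group strategy-proofness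
-- (`RichDomain.groupStrategyProof`). Maskin monotonicity lets single-peaked deviators be given
-- preferences peaked at the target outcome. Single-dipped deviators remain; their upper contour
-- sets at the target are nested, so they can return to the truth one by one.
--
-- Statement (i) follows at once: a dominating alternative lies in the range, so moving to it would
-- benefit everybody.
--
-- For (ii), once the single-peaked reports are fixed the outcome cannot take three values
-- (`RichDomain.not_three_attained`). If an efficient rule skips `x` but attains an interior
-- alternative, efficiency produces three such values. Hence only extremes are attained, and
-- efficiency excludes a constant rule.
--
-- For (iii), a two-valued group strategy-proof rule is monotone in the set of agents preferring `M`
-- to `m`. If `m` is dominated, every single-dipped agent prefers `M` to `m`, so `m` cannot be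
-- chosen when `M` is attainable at the same single-peaked rankings. Conversely, peaks at a skipped
-- alternative leave those rankings free, and efficiency then forces either extreme.
/-- If the outcome differs between two profiles, then some agent whose report differs strictly
prefers the outcome of truth-telling. -/
def GroupStrategyProof {α N : Type*} {T : N → Type*} (P : ∀ i, T i → α → α → Prop)
    (f : (∀ i, T i) → α) : Prop :=
  ∀ R R', f R ≠ f R' → ∃ i, R i ≠ R' i ∧ P i (R i) (f R) (f R')

/-- No alternative is strictly better than the chosen one for everybody. -/
def Efficient {α N : Type*} {T : N → Type*} (P : ∀ i, T i → α → α → Prop)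
    (f : (∀ i, T i) → α) : Prop :=
  ∀ R x, ∃ i, ¬ P i (R i) x (f R)

theorem Efficient.ne_of_forall {α N : Type*} {T : N → Type*} {P : ∀ i, T i → α → α → Prop}
    {f : (∀ i, T i) → α} (hE : Efficient P f) (R : ∀ i, T i) {x y : α}
    (hx : ∀ i, P i (R i) x y) : f R ≠ y := by
  rintro rfl
  obtain ⟨i, hi⟩ := hE R x
  exact hi (hx i)

theorem exists_extension {N : Type*} {T : N → Type*} (Q : (i : N) → T i → Prop) (S : Set N) (R : ∀ i, T i)
    (hQ : ∀ i ∈ S, ∃ t, Q i t) :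
    ∃ R' : ∀ i, T i, (∀ i ∈ S, Q i (R' i)) ∧ ∀ i ∉ S, R' i = R i := by
  have : ∀ i, ∃ t, (i ∈ S → Q i t) ∧ (i ∉ S → t = R i) := by
    intro i
    by_cases hi : i ∈ S
    · obtain ⟨t, ht⟩ := hQ i hi
      exact ⟨t, fun _ => ht, fun hh => absurd hi hh⟩
    · exact ⟨R i, fun hh => absurd hh hi, fun _ => rfl⟩
  choose R' hR' using this
  exact ⟨R', fun i => (hR' i).1, fun i => (hR' i).2⟩

/-! ### Single-peaked and single-dipped preferences on a linear order -/

section Order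

variable {α : Type*} [LinearOrder α]

/-- The strict preference `r` improves towards `ρ` on each side of `ρ`. -/
def PeakAt (r : α → α → Prop) (ρ : α) : Prop :=
  ∀ x y, (x ≤ ρ ∧ y < x) ∨ (ρ ≤ x ∧ x < y) → r x y

/-- The strict preference `r` worsens towards `δ` on each side of `δ`. -/
def DipAt (r : α → α → Prop) (δ : α) : Prop :=
  ∀ x y, (x ≤ δ ∧ y < x) ∨ (δ ≤ x ∧ x < y) → r y x

/-- Single-peaked with every point right of the peak better than every point left of it. -/
def RightPeak (r : α → α → Prop) (ρ : α) : Prop :=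
  PeakAt r ρ ∧ ∀ x y, ρ ≤ x → y < ρ → r x y

/-- Single-peaked with every point left of the peak better than every point right of it. -/
def LeftPeak (r : α → α → Prop) (ρ : α) : Prop :=
  PeakAt r ρ ∧ ∀ x y, x ≤ ρ → ρ < y → r x y

/-- Single-dipped with every point right of the dip better than every point left of it. -/
def RightDip (r : α → α → Prop) (δ : α) : Prop :=
  DipAt r δ ∧ ∀ x y, δ < x → y ≤ δ → r x y

/-- Single-dipped with every point left of the dip better than every point right of it. -/
def LeftDip (r : α → α → Prop) (δ : α) : Prop :=
  DipAt r δ ∧ ∀ x y, x < δ → δ ≤ y → r x y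

theorem PeakAt.dual {r : α → α → Prop} {ρ : α} (h : PeakAt r ρ) :
    PeakAt (α := αᵒᵈ) r ρ :=
  fun x y hxy => h x y hxy.symm

theorem DipAt.dual {r : α → α → Prop} {δ : α} (h : DipAt r δ) :
    DipAt (α := αᵒᵈ) r δ :=
  fun x y hxy => h x y hxy.symm

/-- A domain of strict preferences: the agents in `A` have single-peaked, the other agents
single-dipped preferences, and the domain contains the one-sided preferences with any peak or
dip. -/
structure RichDomain {N : Type*} {T : N → Type*} (A : Set N)
    (P : ∀ i, T i → α → α → Prop) : Prop where
  asymm : ∀ i t x y, P i t x y → ¬ P i t y x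
  trans : ∀ i t x y z, P i t x y → P i t y z → P i t x z
  total : ∀ i t x y, x ≠ y → P i t x y ∨ P i t y x
  peaked : ∀ i ∈ A, ∀ t, ∃ ρ, PeakAt (P i t) ρ
  dipped : ∀ i ∉ A, ∀ t, ∃ δ, DipAt (P i t) δ
  rightPeak : ∀ i ∈ A, ∀ ρ, ∃ t, RightPeak (P i t) ρ
  leftPeak : ∀ i ∈ A, ∀ ρ, ∃ t, LeftPeak (P i t) ρ
  rightDip : ∀ i ∉ A, ∀ δ, ∃ t, RightDip (P i t) δ
  leftDip : ∀ i ∉ A, ∀ δ, ∃ t, LeftDip (P i t) δ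

/-- The upper contour sets of two single-dipped preferences at `w` are nested as soon as both
prefer `w` to a common alternative. -/
theorem DipAt.upperContour_subset_total {r s : α → α → Prop} {δ ε x w : α}
    (hr : DipAt r δ) (hs : DipAt s ε)
    (rasymm : ∀ x y, r x y → ¬ r y x) (rtrans : ∀ x y z, r x y → r y z → r x z)
    (sasymm : ∀ x y, s x y → ¬ s y x) (strans : ∀ x y z, s x y → s y z → s x z)
    (stotal : ∀ x y, x ≠ y → s x y ∨ s y x) (rtotal : ∀ x y, x ≠ y → r x y ∨ r y x)
    (hrw : r w x) (hsw : s w x) :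
    {z | z = w ∨ r z w} ⊆ {z | z = w ∨ s z w} ∨ {z | z = w ∨ s z w} ⊆ {z | z = w ∨ r z w} := by
  by_contra hcon
  push Not at hcon
  obtain ⟨h1, h2⟩ := hcon
  obtain ⟨a, ha, ha'⟩ := Set.not_subset.1 h1
  obtain ⟨b, hb, hb'⟩ := Set.not_subset.1 h2
  simp only [Set.mem_ofPred_eq, not_or] at ha ha' hb hb'
  have ha := ha.resolve_left ha'.1
  have hb := hb.resolve_left hb'.1
  have hwa := (stotal _ _ ha'.1).resolve_left ha'.2
  have hwb := (rtotal _ _ hb'.1).resolve_left hb'.2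
  have hrab := rtrans _ _ _ ha hwb
  have hsab := strans _ _ _ hb hwa
  -- A point strictly between two others is never better than both. So `b`, `x` lie on the same side
  -- of `w` by `r`, and `a`, `x` by `s`; whichever of `a`, `b` is nearer to `w` then violates this.
  have key : ∀ (r : α → α → Prop) (δ : α), DipAt r δ → (∀ x y, r x y → ¬ r y x) →
      ∀ p q m, r m p → r m q → p < m → m < q → False := by
    intro r δ hr ras p q m h1 h2 h3 h4
    rcases le_total m δ with h | h
    · exact ras _ _ h1 (hr m p (.inl ⟨h, h3⟩))
    · exact ras _ _ h2 (hr m q (.inr ⟨h, h4⟩))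
  have kr := key r δ hr rasymm
  have ks := key s ε hs sasymm
  have hxw : x ≠ w := fun h => rasymm _ _ hrw (h ▸ hrw)
  have hab : a ≠ b := fun h => rasymm _ _ hrab (h ▸ hrab)
  have e₁ := kr b x w hwb hrw
  have e₂ := kr x b w hrw hwb
  have e₃ := ks a x w hwa hsw
  have e₄ := ks x a w hsw hwa
  have e₅ := kr b w a hrab ha
  have e₆ := kr w b a ha hrab
  have e₇ := ks a w b hsab hb
  have e₈ := ks w a b hb hsab
  clear kr ks key h1 h2
  rcases lt_or_gt_of_ne hxw with hx | hx <;> rcases lt_or_gt_of_ne ha'.1 with h1 | h1 <;>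
    rcases lt_or_gt_of_ne hb'.1 with h2 | h2 <;> rcases lt_or_gt_of_ne hab with h3 | h3 <;>
    first
      | exact e₁ h2 hx | exact e₂ hx h2 | exact e₃ h1 hx | exact e₄ hx h1
      | exact e₅ h3 h1 | exact e₆ h1 h3 | exact e₇ h3 h2 | exact e₈ h2 h3

section Domain

variable {N : Type*} {T : N → Type*} {A : Set N} {P : ∀ i, T i → α → α → Prop}
  {f : (∀ i, T i) → α}

/-- Reversing the order swaps left and right but preserves peaks and dips, so later results transfer
to their mirror images. -/
theorem RichDomain.dual (h : RichDomain A P) : RichDomain (α := αᵒᵈ) A P where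
  asymm := h.asymm
  trans := h.trans
  total := h.total
  peaked i hi t := (h.peaked i hi t).imp fun _ => PeakAt.dual
  dipped i hi t := (h.dipped i hi t).imp fun _ => DipAt.dual
  rightPeak i hi ρ := (h.leftPeak i hi ρ).imp fun _ ht => ⟨ht.1.dual, ht.2⟩
  leftPeak i hi ρ := (h.rightPeak i hi ρ).imp fun _ ht => ⟨ht.1.dual, ht.2⟩
  rightDip i hi ρ := (h.leftDip i hi ρ).imp fun _ ht => ⟨ht.1.dual, ht.2⟩
  leftDip i hi ρ := (h.rightDip i hi ρ).imp fun _ ht => ⟨ht.1.dual, ht.2⟩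

theorem RichDomain.irrefl (h : RichDomain A P) (i : N) (t : T i) (x : α) : ¬ P i t x x :=
  fun hx => h.asymm i t x x hx hx

theorem RichDomain.of_not (h : RichDomain A P) {i : N} {t : T i} {x y : α} (hxy : x ≠ y)
    (hn : ¬ P i t x y) : P i t y x :=
  (h.total i t x y hxy).resolve_left hn

/-! ### From strategy-proofness to group strategy-proofness -/

/-- Maskin monotonicity of strategy-proof rules. -/
theorem RichDomain.maskin [Finite N] (h : RichDomain A P)
    (hf : ∀ R i t, ¬ P i (R i) (f (Function.update R i t)) (f R)) {R R' : ∀ i, T i}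
    (hR : ∀ i z, P i (R' i) z (f R) → P i (R i) z (f R)) : f R' = f R := by
  have := Fintype.ofFinite N
  have key : ∀ s : Finset N, f (s.piecewise R' R) = f R := by
    intro s
    induction s using Finset.induction_on with
    | empty => simp
    | insert i s hi ih =>
      rw [Finset.piecewise_insert]
      set Q := s.piecewise R' R with hQ
      have hQi : Q i = R i := by simp [hQ, hi]
      by_contra hne
      -- If switching `i` changed the outcome, `R i` would not favour the new one, hence by `hR`
      -- neither would `R' i`; an agent with preference `R' i` would then gain by reporting `R i`.
      have h1 := hf Q i (R' i)
      rw [ih, hQi] at h1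
      have h2 := h.of_not hne (fun hh => h1 (hR i _ hh))
      have h3 := hf (Function.update Q i (R' i)) i (Q i)
      simp only [Function.update_idem, Function.update_eq_self, Function.update_self] at h3
      rw [ih] at h3
      exact h3 h2
  simpa using key Finset.univ

/-- A coalition of agents with single-dipped preferences cannot manipulate. -/
theorem RichDomain.coalition_eq_empty (h : RichDomain A P)
    (hf : ∀ R i t, ¬ P i (R i) (f (Function.update R i t)) (f R)) (R : ∀ i, T i) :
    ∀ (n : ℕ) (C : Finset N), C.card = n → (∀ i ∈ C, i ∉ A) → ∀ Q : ∀ i, T i,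
      (∀ i ∉ C, Q i = R i) → (∀ i ∈ C, P i (R i) (f Q) (f R)) → C = ∅ := by
  intro n
  induction n with
  | zero => exact fun C hC _ _ _ _ => Finset.card_eq_zero.1 hC
  | succ n ih =>
    intro C hC hCA Q hQ hP
    exfalso
    have hne : C.Nonempty := Finset.card_pos.1 (by omega)
    -- By nestedness, what this agent weakly prefers to `f Q` is so preferred by all of `C`. When
    -- `i` returns to the truth, the outcome stays in that set and the other members still gain, so
    -- induction applies.
    obtain ⟨i, hi, hmin⟩ := C.exists_minimalFor
      (fun i => {z | z = f Q ∨ P i (R i) z (f Q)}) hne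
    have hsub : ∀ j ∈ C, {z | z = f Q ∨ P i (R i) z (f Q)} ⊆
        {z | z = f Q ∨ P j (R j) z (f Q)} := by
      intro j hj
      obtain ⟨δ, hδ⟩ := h.dipped i (hCA i hi) (R i)
      obtain ⟨ε, hε⟩ := h.dipped j (hCA j hj) (R j)
      rcases hδ.upperContour_subset_total hε (h.asymm i _) (h.trans i _) (h.asymm j _)
        (h.trans j _) (h.total j _) (h.total i _) (hP i hi) (hP j hj) with h1 | h1
      · exact h1
      · exact hmin hj h1
    set Q' := Function.update Q i (R i) with hQ'
    have hmem : f Q' ∈ {z | z = f Q ∨ P i (R i) z (f Q)} := by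
      by_contra hcon
      simp only [Set.mem_ofPred_eq, not_or] at hcon
      have h1 := h.of_not hcon.1 hcon.2
      have h2 := hf Q' i (Q i)
      simp only [hQ', Function.update_idem, Function.update_eq_self, Function.update_self] at h2
      exact h2 h1
    have hP' : ∀ j ∈ C, P j (R j) (f Q') (f R) := by
      intro j hj
      rcases hsub j hj hmem with h1 | h1
      · rw [h1]; exact hP j hj
      · exact h.trans _ _ _ _ _ h1 (hP j hj)
    have hQR : ∀ j ∉ C.erase i, Q' j = R j := by
      intro j hj
      by_cases hji : j = i
      · subst hji; simp [hQ']
      · rw [hQ', Function.update_of_ne hji]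
        exact hQ j (fun hjC => hj (Finset.mem_erase.2 ⟨hji, hjC⟩))
    have hemp := ih (C.erase i) (by rw [Finset.card_erase_of_mem hi]; omega)
      (fun j hj => hCA j (Finset.mem_of_mem_erase hj)) Q' hQR
      (fun j hj => hP' j (Finset.mem_of_mem_erase hj))
    have heq : Q' = R := funext fun j => hQR j (by simp [hemp])
    have := hP' i hi
    rw [heq] at this
    exact h.irrefl _ _ _ this

/-- Every alternative `y` is the peak of a preference for which everything weakly better than
`x` lies between `x` and `y`. -/
theorem RichDomain.exists_peak_uIcc (h : RichDomain A P) {i : N} (hi : i ∈ A) (x y : α) :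
    ∃ t, PeakAt (P i t) y ∧ ∀ z, P i t z x → z ∈ Set.uIcc x y := by
  rcases le_total x y with hxy | hxy
  · obtain ⟨t, ht, ht'⟩ := h.leftPeak i hi y
    refine ⟨t, ht, fun z hz => ?_⟩
    rw [Set.uIcc_of_le hxy]
    constructor
    · by_contra! hzx
      exact h.asymm _ _ _ _ hz (ht x z (.inl ⟨hxy, hzx⟩))
    · by_contra! hzx
      exact h.asymm _ _ _ _ hz (ht' x z hxy hzx)
  · obtain ⟨t, ht, ht'⟩ := h.rightPeak i hi y
    refine ⟨t, ht, fun z hz => ?_⟩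
    rw [Set.uIcc_of_ge hxy]
    constructor
    · by_contra! hzx
      exact h.asymm _ _ _ _ hz (ht' x z hxy hzx)
    · by_contra! hzx
      exact h.asymm _ _ _ _ hz (ht x z (.inr ⟨hxy, hzx⟩))

/-- From `x` towards `y` the preference rises up to the peak and, past the peak, stays above `y`. -/
theorem PeakAt.of_mem_uIcc {r : α → α → Prop} {ρ x y z : α} (hr : PeakAt r ρ)
    (asymm : ∀ x y, r x y → ¬ r y x) (trans : ∀ x y z, r x y → r y z → r x z)
    (hyx : r y x) (hz : z ∈ Set.uIcc x y) (hzx : z ≠ x) : r z x := by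
  have h1 := hr x y
  have h2 := hr z x
  have h3 := hr z y
  have h4 := asymm y x hyx
  have h5 := trans z y x
  rw [Set.mem_uIcc] at hz
  grind

/-- Strategy-proof rules on a rich domain are group strategy-proof. -/
theorem RichDomain.groupStrategyProof [Finite N] (h : RichDomain A P)
    (hf : ∀ R i t, ¬ P i (R i) (f (Function.update R i t)) (f R)) :
    GroupStrategyProof P f := by
  intro R R' hne
  by_contra! hcon
  have hpref : ∀ i, R i ≠ R' i → P i (R i) (f R') (f R) := fun i hi => h.of_not hne (hcon i hi)
  have hex : ∀ i, ∃ t, i ∈ A → PeakAt (P i t) (f R') ∧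
      ∀ z, P i t z (f R) → z ∈ Set.uIcc (f R) (f R') := by
    intro i
    by_cases hi : i ∈ A
    · exact (h.exists_peak_uIcc hi (f R) (f R')).imp fun _ ht _ => ht
    · exact ⟨R i, fun hh => absurd hh hi⟩
  choose E hE using hex
  let R₁ : ∀ i, T i := fun i => if i ∈ A ∧ R i ≠ R' i then E i else R i
  let R₂ : ∀ i, T i := fun i => if i ∈ A ∧ R i ≠ R' i then E i else R' i
  have h₁ : f R₁ = f R := by
    refine h.maskin hf fun i z hz => ?_
    by_cases hi : i ∈ A ∧ R i ≠ R' i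
    · simp only [R₁, if_pos hi] at hz
      -- The new preference ranks above `f R` only points between `f R` and `f R'`, all of which `R
      -- i` already ranks above `f R`.
      obtain ⟨ρ, hρ⟩ := h.peaked i hi.1 (R i)
      refine hρ.of_mem_uIcc (h.asymm _ _) (h.trans _ _) (hpref i hi.2) ((hE i hi.1).2 z hz) ?_
      rintro rfl
      exact h.irrefl _ _ _ hz
    · simpa only [R₁, if_neg hi] using hz
  have h₂ : f R₂ = f R' := by
    refine h.maskin hf fun i z hz => ?_
    by_cases hi : i ∈ A ∧ R i ≠ R' i
    · simp only [R₂, if_pos hi] at hz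
      exfalso
      have hpk := (hE i hi.1).1
      rcases lt_trichotomy z (f R') with hlt | heq | hlt
      · exact h.asymm _ _ _ _ hz (hpk _ z (.inl ⟨le_rfl, hlt⟩))
      · exact h.irrefl _ _ _ (heq ▸ hz)
      · exact h.asymm _ _ _ _ hz (hpk _ z (.inr ⟨le_rfl, hlt⟩))
    · simpa only [R₂, if_neg hi] using hz
  have := Fintype.ofFinite N
  -- `R₁` and `R₂` differ only at single-dipped agents, all of whom gain from the move.
  have hemp := h.coalition_eq_empty hf R₁ _
    (Finset.univ.filter fun i => i ∉ A ∧ R i ≠ R' i) rfl (by simp +contextual) R₂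
    (by
      intro i hi
      simp only [Finset.mem_filter, Finset.mem_univ, true_and, not_and] at hi
      by_cases hiA : i ∈ A ∧ R i ≠ R' i
      · simp [R₁, R₂, hiA]
      · simp only [R₁, R₂, if_neg hiA]
        by_contra hne
        exact hiA ⟨by_contra fun hA => hi hA (Ne.symm hne), Ne.symm hne⟩)
    (by
      intro i hi
      simp only [Finset.mem_filter, Finset.mem_univ, true_and] at hi
      rw [h₁, h₂]
      simpa [R₁, hi.1] using hpref i hi.2)
  refine hne ?_
  rw [← h₁, ← h₂]
  congr 1
  funext i
  by_cases hiA : i ∈ A ∧ R i ≠ R' i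
  · simp [R₁, R₂, hiA]
  · simp only [R₁, R₂, if_neg hiA]
    by_contra hne
    have : i ∈ (Finset.univ.filter fun i => i ∉ A ∧ R i ≠ R' i) := by
      simp only [Finset.mem_filter, Finset.mem_univ, true_and]
      exact ⟨fun hA => hiA ⟨hA, hne⟩, hne⟩
    simp [hemp] at this

/-! ### Attainable outcomes for fixed single-peaked reports -/

/-- When the reports of the agents with single-peaked preferences are fixed, no three
alternatives can be attained. -/
theorem RichDomain.not_three_attained [Finite N] (h : RichDomain A P)
    (hf : ∀ R i t, ¬ P i (R i) (f (Function.update R i t)) (f R)) {R Rl Rz : ∀ i, T i}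
    (hRl : ∀ i ∈ A, Rl i = R i) (hRz : ∀ i ∈ A, Rz i = R i)
    (hlt : f Rl < f R) (htz : f R < f Rz) : False := by
  have hG := h.groupStrategyProof hf
  set l := f Rl with hl
  set t := f R with ht
  set z := f Rz with hz
  have hexR : ∀ δ i, ∃ s, i ∉ A → RightDip (P i s) δ := by
    intro δ i
    by_cases hi : i ∈ A
    · exact ⟨R i, fun hh => absurd hi hh⟩
    · exact (h.rightDip i hi δ).imp fun _ ht _ => ht
  have hexL : ∀ δ i, ∃ s, i ∉ A → LeftDip (P i s) δ := by
    intro δ i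
    by_cases hi : i ∈ A
    · exact ⟨R i, fun hh => absurd hi hh⟩
    · exact (h.leftDip i hi δ).imp fun _ ht _ => ht
  choose inc hinc using hexR l
  choose dec hdec using hexL z
  choose dtr hdtr using hexR t
  choose dtl hdtl using hexL t
  -- Agents whose dip is forced left of `t` report `a`, those whose dip is forced right of `t`
  -- report `b`; for the remaining single-dipped agents `t` is the worst of `l`, `t`, `z`.
  let E : (∀ i, T i) → (∀ i, T i) → ∀ i, T i := fun a b i =>
    if i ∉ A ∧ P i (R i) t l then a i else if i ∉ A ∧ P i (R i) t z then b i else R i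
  have hdisj : ∀ i ∉ A, P i (R i) t l → P i (R i) t z → False := by
    intro i hi h1 h2
    obtain ⟨δ, hδ⟩ := h.dipped i hi (R i)
    rcases le_total t δ with h3 | h3
    · exact h.asymm _ _ _ _ h1 (hδ t l (.inl ⟨h3, hlt⟩))
    · exact h.asymm _ _ _ _ h2 (hδ t z (.inr ⟨h3, htz⟩))
  have hEA : ∀ a b, ∀ i ∈ A, E a b i = R i := fun a b i hi => by simp [E, hi]
  have hE₁ : ∀ a b i, i ∉ A → P i (R i) t l → E a b i = a i := fun a b i hi h1 => by
    simp [E, hi, h1]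
  have hE₂ : ∀ a b i, i ∉ A → P i (R i) t z → E a b i = b i := fun a b i hi h1 => by
    have h2 : ¬ P i (R i) t l := fun h2 => hdisj i hi h2 h1
    simp [E, hi, h1, h2]
  have hE₃ : ∀ a b i, ¬ P i (R i) t l → ¬ P i (R i) t z → E a b i = R i := fun a b i h1 h2 => by
    simp [E, h1, h2]
  have hdl : ∀ i ∉ A, ∀ b, LeftDip (P i (b i)) t ∨ LeftDip (P i (b i)) z →
      P i (E dtr b i) l t := by
    intro i hi b hb
    by_cases h1 : P i (R i) t l
    · rw [hE₁ _ _ i hi h1]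
      exact (hdtr i hi).1 t l (.inl ⟨le_rfl, hlt⟩)
    by_cases h2 : P i (R i) t z
    · rw [hE₂ _ _ i hi h2]
      rcases hb with hb | hb
      · exact hb.1 t l (.inl ⟨le_rfl, hlt⟩)
      · exact hb.1 t l (.inl ⟨htz.le, hlt⟩)
    · rw [hE₃ _ _ i h1 h2]
      exact h.of_not hlt.ne' h1
  have hdr : ∀ i ∉ A, ∀ a, RightDip (P i (a i)) t ∨ RightDip (P i (a i)) l →
      P i (E a dtl i) z t := by
    intro i hi a hb
    by_cases h2 : P i (R i) t z
    · rw [hE₂ _ _ i hi h2]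
      exact (hdtl i hi).1 t z (.inr ⟨le_rfl, htz⟩)
    by_cases h1 : P i (R i) t l
    · rw [hE₁ _ _ i hi h1]
      rcases hb with hb | hb
      · exact hb.1 t z (.inr ⟨le_rfl, htz⟩)
      · exact hb.1 t z (.inr ⟨hlt.le, htz⟩)
    · rw [hE₃ _ _ i h1 h2]
      exact h.of_not htz.ne h2
  -- Here all single-dipped agents prefer `l` to `t`, so at outcome `t` they would jointly move to
  -- `Rl`.
  have hnl : ∀ b, (∀ i ∉ A, LeftDip (P i (b i)) t ∨ LeftDip (P i (b i)) z) →
      f (E dtr b) ≠ t := by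
    intro b hb heq
    obtain ⟨i, hi, hP⟩ := hG (E dtr b) Rl (by rw [heq, ← hl]; exact hlt.ne')
    have hiA : i ∉ A := fun hA => hi (by rw [hEA _ _ i hA, hRl i hA])
    rw [heq, ← hl] at hP
    exact h.asymm _ _ _ _ hP (hdl i hiA b (hb i hiA))
  have hnr : ∀ a, (∀ i ∉ A, RightDip (P i (a i)) t ∨ RightDip (P i (a i)) l) →
      f (E a dtl) ≠ t := by
    intro a hb heq
    obtain ⟨i, hi, hP⟩ := hG (E a dtl) Rz (by rw [heq, ← hz]; exact htz.ne)
    have hiA : i ∉ A := fun hA => hi (by rw [hEA _ _ i hA, hRz i hA])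
    rw [heq, ← hz] at hP
    exact h.asymm _ _ _ _ hP (hdr i hiA a (hb i hiA))
  have h0 : f (E inc dec) = t := by
    refine h.maskin hf fun i w hw => ?_
    rw [← ht] at hw ⊢
    by_cases hi : i ∈ A
    · rwa [hEA _ _ i hi] at hw
    obtain ⟨δ, hδ⟩ := h.dipped i hi (R i)
    by_cases h1 : P i (R i) t l
    · rw [hE₁ _ _ i hi h1] at hw
      have hδt : δ < t := by
        by_contra! h3
        exact h.asymm _ _ _ _ h1 (hδ t l (.inl ⟨h3, hlt⟩))
      rcases lt_trichotomy w t with h4 | h4 | h4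
      · exfalso
        refine h.asymm _ _ _ _ hw ?_
        rcases le_total w l with h5 | h5
        · exact (hinc i hi).2 _ _ hlt h5
        · exact (hinc i hi).1 _ _ (.inr ⟨h5, h4⟩)
      · exact absurd (h4 ▸ hw) (h.irrefl _ _ _)
      · exact hδ _ _ (.inr ⟨hδt.le, h4⟩)
    by_cases h2 : P i (R i) t z
    · rw [hE₂ _ _ i hi h2] at hw
      have hδt : t < δ := by
        by_contra! h3
        exact h.asymm _ _ _ _ h2 (hδ t z (.inr ⟨h3, htz⟩))
      rcases lt_trichotomy w t with h4 | h4 | h4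
      · exact hδ _ _ (.inl ⟨hδt.le, h4⟩)
      · exact absurd (h4 ▸ hw) (h.irrefl _ _ _)
      · exfalso
        refine h.asymm _ _ _ _ hw ?_
        rcases le_total w z with h5 | h5
        · exact (hdec i hi).1 _ _ (.inl ⟨h5, h4⟩)
        · exact (hdec i hi).2 _ _ htz h5
    · rwa [hE₃ _ _ i h1 h2] at hw
  have hdiff₁ : ∀ a a' b i, E a b i ≠ E a' b i → i ∉ A ∧ E a b i = a i := by
    intro a a' b i hi
    by_cases h1 : i ∉ A ∧ P i (R i) t l
    · exact ⟨h1.1, hE₁ _ _ _ h1.1 h1.2⟩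
    · simp only [E, if_neg h1] at hi
      exact absurd rfl hi
  have hdiff₂ : ∀ a b b' i, E a b i ≠ E a b' i → i ∉ A ∧ E a b i = b i := by
    intro a b b' i hi
    by_cases h1 : i ∉ A ∧ P i (R i) t z
    · exact ⟨h1.1, hE₂ _ _ _ h1.1 h1.2⟩
    · simp only [E, if_neg h1] at hi
      exact absurd rfl hi
  have hv : f (E dtr dec) < t := by
    have hne := hnl dec fun i hi => .inr (hdec i hi)
    obtain ⟨i, hi, hP⟩ := hG (E inc dec) (E dtr dec) (by rw [h0]; exact hne.symm)
    obtain ⟨hiA, hi⟩ := hdiff₁ _ _ _ i hi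
    rw [h0, hi] at hP
    refine lt_of_le_of_ne ?_ hne
    by_contra! h3
    exact h.asymm _ _ _ _ hP ((hinc i hiA).1 _ _ (.inr ⟨hlt.le, h3⟩))
  have hv' : t < f (E inc dtl) := by
    have hne := hnr inc fun i hi => .inr (hinc i hi)
    obtain ⟨i, hi, hP⟩ := hG (E inc dec) (E inc dtl) (by rw [h0]; exact hne.symm)
    obtain ⟨hiA, hi⟩ := hdiff₂ _ _ _ i hi
    rw [h0, hi] at hP
    refine lt_of_le_of_ne ?_ hne.symm
    by_contra! h3
    exact h.asymm _ _ _ _ hP ((hdec i hiA).1 _ _ (.inl ⟨htz.le, h3⟩))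
  -- With both groups' dips at `t`, either outcome fails: left of `t` the first group moves to
  -- `inc`, right of `t` the second moves to `dec`.
  rcases lt_or_gt_of_ne (hnl dtl fun i hi => .inl (hdtl i hi)) with hw | hw
  · obtain ⟨i, hi, hP⟩ := hG (E dtr dtl) (E inc dtl) (hw.trans hv').ne
    obtain ⟨hiA, hi⟩ := hdiff₁ _ _ _ i hi
    rw [hi] at hP
    exact h.asymm _ _ _ _ hP ((hdtr i hiA).2 _ _ hv' hw.le)
  · obtain ⟨i, hi, hP⟩ := hG (E dtr dtl) (E dtr dec) (hv.trans hw).ne'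
    obtain ⟨hiA, hi⟩ := hdiff₂ _ _ _ i hi
    rw [hi] at hP
    exact h.asymm _ _ _ _ hP ((hdtl i hiA).2 _ _ hv hw.le)

/-! ### Range of an efficient rule that skips an alternative -/

/-- An efficient rule never skips an interior alternative that lies left of an interior
alternative in its range. -/
theorem RichDomain.not_lt_of_notMem_range [Finite N] (h : RichDomain A P)
    (hf : ∀ R i t, ¬ P i (R i) (f (Function.update R i t)) (f R)) (hE : Efficient P f)
    {x u : α} (hx : ∀ R, f R ≠ x) {R : ∀ i, T i} (hxy : x < f R) (hu : f R < u) : False := by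
  have hG := h.groupStrategyProof hf
  obtain ⟨R₁, h₁A, h₁D⟩ := exists_extension (fun i t => RightPeak (P i t) x) A R
    fun i hi => h.rightPeak i hi x
  have hxt : x < f R₁ ∧ f R₁ ≤ f R := by
    by_cases heq : f R₁ = f R
    · rw [heq]; exact ⟨hxy, le_rfl⟩
    obtain ⟨i, hi, hP⟩ := hG R₁ R heq
    have hiA : i ∈ A := by_contra fun hA => hi (h₁D i hA)
    have hpk := h₁A i hiA
    constructor
    · refine lt_of_le_of_ne ?_ (hx R₁).symm
      by_contra! h1
      exact h.asymm _ _ _ _ hP (hpk.2 _ _ hxy.le h1)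
    · by_contra! h1
      exact h.asymm _ _ _ _ hP (hpk.1 _ _ (.inr ⟨hxy.le, h1⟩))
  obtain ⟨hxt, hty⟩ := hxt
  have htu := hty.trans_lt hu
  obtain ⟨Rl, hlD, hlA⟩ := exists_extension (fun i t => LeftDip (P i t) (f R₁)) Aᶜ R₁
    fun i hi => h.leftDip i hi _
  obtain ⟨Rz, hzD, hzA⟩ := exists_extension (fun i t => RightDip (P i t) (f R₁)) Aᶜ R₁
    fun i hi => h.rightDip i hi _
  obtain ⟨Ru, huA, huD⟩ := exists_extension (fun i t => RightPeak (P i t) u) A Rz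
    fun i hi => h.rightPeak i hi u
  have hlA' : ∀ i ∈ A, Rl i = R₁ i := fun i hi => hlA i (by simpa using hi)
  have hzA' : ∀ i ∈ A, Rz i = R₁ i := fun i hi => hzA i (by simpa using hi)
  -- Anything right of `x` would be dominated by `x`: it is the peak on `A`, and the left dips at `f
  -- R₁ > x` favour it too.
  have hl : f Rl < x := by
    refine lt_of_le_of_ne ?_ (hx Rl)
    by_contra! h1
    refine hE.ne_of_forall Rl (x := x) (y := f Rl) (fun i => ?_) rfl
    by_cases hi : i ∈ A
    · rw [hlA' i hi]
      exact (h₁A i hi).1 _ _ (.inr ⟨le_rfl, h1⟩)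
    · rcases le_total (f Rl) (f R₁) with h2 | h2
      · exact (hlD i hi).1 _ _ (.inl ⟨h2, h1⟩)
      · exact (hlD i hi).2 _ _ hxt h2
  -- `Ru` serves to exclude `f Rz < x`: from there the agents of `A`, who rank everything right of
  -- `x` above everything left of it, would move to `Ru`.
  have hfu : u ≤ f Ru := by
    by_contra! h1
    refine hE.ne_of_forall Ru (x := u) (y := f Ru) (fun i => ?_) rfl
    by_cases hi : i ∈ A
    · exact (huA i hi).1 _ _ (.inl ⟨le_rfl, h1⟩)
    · rw [huD i hi]
      rcases le_total (f Ru) (f R₁) with h2 | h2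
      · exact (hzD i hi).2 _ _ htu h2
      · exact (hzD i hi).1 _ _ (.inr ⟨h2, h1⟩)
  have hxz : x < f Rz := by
    refine lt_of_le_of_ne ?_ (hx Rz).symm
    by_contra! h1
    obtain ⟨i, hi, hP⟩ := hG Rz Ru ((h1.trans (hxt.trans htu)).trans_le hfu).ne
    have hiA : i ∈ A := by_contra fun hA => hi (huD i hA).symm
    rw [hzA' i hiA] at hP
    exact h.asymm _ _ _ _ hP ((h₁A i hiA).2 _ _ ((hxt.trans htu).le.trans hfu) h1)
  have hz : f R₁ < f Rz := by
    by_contra! h1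
    refine hE.ne_of_forall Rz (x := x) (y := f Rz) (fun i => ?_) rfl
    by_cases hi : i ∈ A
    · rw [hzA' i hi]
      exact (h₁A i hi).1 _ _ (.inr ⟨le_rfl, hxz⟩)
    · exact (hzD i hi).1 _ _ (.inl ⟨h1, hxz⟩)
  exact h.not_three_attained hf hlA' hzA' (hl.trans hxt) hz

/-- Any alternative in the range of an efficient rule that skips some alternative is extreme. -/
theorem RichDomain.isBot_or_isTop_of_notMem_range [Finite N] (h : RichDomain A P)
    (hf : ∀ R i t, ¬ P i (R i) (f (Function.update R i t)) (f R)) (hE : Efficient P f)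
    {x : α} (hx : ∀ R, f R ≠ x) (R : ∀ i, T i) : IsBot (f R) ∨ IsTop (f R) := by
  by_contra! hcon
  simp only [IsBot, IsTop, not_forall, not_le] at hcon
  obtain ⟨⟨a, ha⟩, b, hb⟩ := hcon
  rcases lt_or_gt_of_ne (hx R) with h1 | h1
  · exact h.dual.not_lt_of_notMem_range (α := αᵒᵈ) hf hE hx h1 ha
  · exact h.not_lt_of_notMem_range hf hE hx h1 hb

/-- The range of an efficient rule that skips some alternative consists of the two extreme
alternatives. -/
theorem RichDomain.exists_range_eq [Finite N] (h : RichDomain A P)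
    (hf : ∀ R i t, ¬ P i (R i) (f (Function.update R i t)) (f R)) (hE : Efficient P f)
    {x : α} (hx : ∀ R, f R ≠ x) (R : ∀ i, T i) :
    ∃ m M, IsBot m ∧ IsTop M ∧ Set.range f = {m, M} := by
  have hext := h.isBot_or_isTop_of_notMem_range hf hE hx
  have hex : ∀ i, ∃ t, (i ∈ A → RightPeak (P i t) x) ∧ (i ∉ A → LeftDip (P i t) (f R)) := by
    intro i
    by_cases hi : i ∈ A
    · exact (h.rightPeak i hi x).imp fun _ ht => ⟨fun _ => ht, fun hh => absurd hi hh⟩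
    · exact (h.leftDip i hi (f R)).imp fun _ ht => ⟨fun hh => absurd hh hi, fun _ => ht⟩
  choose Q hQ using hex
  -- At `Q` everybody prefers `x` to `f R`, so a second value is attained.
  have hne : f Q ≠ f R := by
    refine hE.ne_of_forall Q (x := x) (fun i => ?_)
    rcases lt_or_gt_of_ne (hx R) with h1 | h1
    · by_cases hi : i ∈ A
      · exact ((hQ i).1 hi).1 _ _ (.inl ⟨le_rfl, h1⟩)
      · exact ((hQ i).2 hi).1 _ _ (.inr ⟨le_rfl, h1⟩)
    · by_cases hi : i ∈ A
      · exact ((hQ i).1 hi).1 _ _ (.inr ⟨le_rfl, h1⟩)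
      · exact ((hQ i).2 hi).1 _ _ (.inl ⟨le_rfl, h1⟩)
  have hrange : ∀ m M, IsBot m → IsTop M → m ∈ Set.range f → M ∈ Set.range f →
      Set.range f = {m, M} := by
    intro m M hm hM hmr hMr
    refine Set.Subset.antisymm ?_ (Set.pair_subset hmr hMr)
    rintro _ ⟨R', rfl⟩
    rcases hext R' with h1 | h1
    · exact .inl (le_antisymm (h1 _) (hm _))
    · exact .inr (le_antisymm (hM _) (h1 _))
  rcases hext R with h1 | h1 <;> rcases hext Q with h2 | h2
  · exact absurd (le_antisymm (h2 _) (h1 _)) hne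
  · exact ⟨_, _, h1, h2, hrange _ _ h1 h2 ⟨R, rfl⟩ ⟨Q, rfl⟩⟩
  · exact ⟨_, _, h2, h1, hrange _ _ h2 h1 ⟨Q, rfl⟩ ⟨R, rfl⟩⟩
  · exact absurd (le_antisymm (h1 _) (h2 _)) hne

/-! ### Rules with two extreme outcomes -/

/-- A rule that attains `M` at `R'` does not choose `m` at `R`, if everybody preferring `M` to `m`
at `R'` does so at `R`. -/
theorem GroupStrategyProof.ne_of_monotone (h : RichDomain A P) (hG : GroupStrategyProof P f)
    {m M : α} (hmM : m ≠ M) (hrange : ∀ R, f R = m ∨ f R = M) {R R' : ∀ i, T i}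
    (hR' : f R' = M) (hmono : ∀ i, P i (R' i) M m → P i (R i) M m) : f R ≠ m := by
  intro hR
  -- Between `R'` and `H` only agents preferring `m` at `R'` change; between `R` and `H` only those
  -- preferring `M` at `R`. Neither value of `f H` is compatible with both.
  let H : ∀ i, T i := fun i => if P i (R i) M m then R' i else R i
  rcases hrange H with hH | hH
  · obtain ⟨i, hi, hP⟩ := hG R' H (by rw [hR', hH]; exact hmM.symm)
    rw [hR', hH] at hP
    simp only [H, if_pos (hmono i hP)] at hi
    exact hi rfl
  · obtain ⟨i, hi, hP⟩ := hG R H (by rw [hR, hH]; exact hmM)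
    rw [hR, hH] at hP
    simp only [H, if_neg (h.asymm _ _ _ _ hP)] at hi
    exact hi rfl

/-- If the least alternative is chosen although everybody prefers `x` to it, then the other
element of the range is not attained when the reports of the agents with single-peaked
preferences rank the two elements of the range as before. -/
theorem GroupStrategyProof.not_dominated (h : RichDomain A P) (hG : GroupStrategyProof P f)
    {m M : α} (hm : IsBot m) (hM : IsTop M) (hmM : m ≠ M) (hrange : ∀ R, f R = m ∨ f R = M)
    {R R' : ∀ i, T i} (hR' : f R' = M)
    (hA : ∀ i ∈ A, P i (R' i) M m → P i (R i) M m) (hR : f R = m) {x : α}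
    (hx : ∀ i, P i (R i) x m) : False := by
  refine hG.ne_of_monotone h hmM hrange hR' (fun i hi => ?_) hR
  by_cases hiA : i ∈ A
  · exact hA i hiA hi
  obtain ⟨δ, hδ⟩ := h.dipped i hiA (R i)
  have hxm : m < x := lt_of_le_of_ne (hm x) fun heq => h.irrefl _ _ _ (heq ▸ hx i)
  -- A single-dipped agent preferring `x` to the bottom is past the dip at `x`, hence likes the top
  -- even more.
  have hδx : δ ≤ x := by
    by_contra! h1
    exact h.asymm _ _ _ _ (hx i) (hδ _ _ (.inl ⟨h1.le, hxm⟩))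
  rcases (hM x).eq_or_lt with h1 | h1
  · exact h1 ▸ hx i
  · exact h.trans _ _ _ _ _ (hδ _ _ (.inr ⟨hδx, h1⟩)) (hx i)

/-- An efficient rule whose range consists of the two extreme alternatives chooses the least one
at some profile with prescribed rankings of the two for the agents with single-peaked
preferences. -/
theorem Efficient.exists_eq_bot (h : RichDomain A P) (hE : Efficient P f)
    {m M x : α} (hm : IsBot m) (hM : IsTop M) (hxm : x ≠ m) (hxM : x ≠ M)
    (hrange : ∀ R, f R = m ∨ f R = M) (B : Set N) :
    ∃ R, f R = m ∧ ∀ i ∈ A, (i ∈ B → P i (R i) M m) ∧ (i ∉ B → P i (R i) m M) := by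
  have hmx := lt_of_le_of_ne (hm x) hxm.symm
  have hxM := lt_of_le_of_ne (hM x) hxM
  have hex : ∀ i, ∃ t, (i ∈ A → PeakAt (P i t) x ∧ (i ∈ B → P i t M m) ∧ (i ∉ B → P i t m M)) ∧
      (i ∉ A → LeftDip (P i t) M) := by
    intro i
    by_cases hi : i ∈ A
    · by_cases hB : i ∈ B
      · obtain ⟨t, ht⟩ := h.rightPeak i hi x
        exact ⟨t, fun _ => ⟨ht.1, fun _ => ht.2 _ _ hxM.le hmx, fun hh => absurd hB hh⟩,
          fun hh => absurd hi hh⟩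
      · obtain ⟨t, ht⟩ := h.leftPeak i hi x
        exact ⟨t, fun _ => ⟨ht.1, fun hh => absurd hh hB, fun _ => ht.2 _ _ hmx.le hxM⟩,
          fun hh => absurd hi hh⟩
    · exact (h.leftDip i hi M).imp fun _ ht => ⟨fun hh => absurd hh hi, fun _ => ht⟩
  choose R hR using hex
  refine ⟨R, (hrange R).resolve_right ?_, fun i hi => ((hR i).1 hi).2⟩
  refine hE.ne_of_forall R (x := x) fun i => ?_
  by_cases hi : i ∈ A
  · exact ((hR i).1 hi).1 _ _ (.inr ⟨le_rfl, hxM⟩)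
  · exact ((hR i).2 hi).1 _ _ (.inl ⟨le_rfl, hxM⟩)

end Domain

end Order

/-! ### Richness of the concrete preference domain -/

section Preferences

variable {X : Set ℝ}

theorem Pref.rel_refl (R : Pref X) (x : X) : R.rel x x :=
  (R.complete x x).elim id id

theorem Pref.strict_iff (R : Pref X) (x y : X) : R.strict x y ↔ ¬ R.rel y x :=
  ⟨And.right, fun h => ⟨(R.complete x y).resolve_right h, h⟩⟩

/-- The reversed preference. -/
def Pref.reverse (R : Pref X) : Pref X where
  rel x y := R.rel y x
  complete x y := R.complete y x
  transitive x y z h1 h2 := R.transitive z y x h2 h1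
  antisymmetric x y h1 h2 := R.antisymmetric x y h2 h1

/-- The preference with peak `ρ` for which all points right of `ρ` are better than all points
left of `ρ`. -/
def Pref.rightPeak (ρ : X) : Pref X where
  rel x y := (ρ ≤ x ∧ (y < ρ ∨ x ≤ y)) ∨ (x < ρ ∧ y < ρ ∧ y ≤ x)
  complete x y := by grind
  transitive x y z := by grind
  antisymmetric x y := by grind

/-- The preference with peak `ρ` for which all points left of `ρ` are better than all points
right of `ρ`. -/
def Pref.leftPeak (ρ : X) : Pref X where
  rel x y := (x ≤ ρ ∧ (ρ < y ∨ y ≤ x)) ∨ (ρ < x ∧ ρ < y ∧ x ≤ y)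
  complete x y := by grind
  transitive x y z := by grind
  antisymmetric x y := by grind

theorem Pref.rightPeak_spec (ρ : X) : RightPeak (Pref.rightPeak ρ).strict ρ := by
  constructor
  · intro x y h
    rw [Pref.strict_iff]
    simp only [Pref.rightPeak]
    grind
  · intro x y h1 h2
    rw [Pref.strict_iff]
    simp only [Pref.rightPeak]
    grind

theorem Pref.leftPeak_spec (ρ : X) : LeftPeak (Pref.leftPeak ρ).strict ρ := by
  constructor
  · intro x y h
    rw [Pref.strict_iff]
    simp only [Pref.leftPeak]
    grind
  · intro x y h1 h2
    rw [Pref.strict_iff]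
    simp only [Pref.leftPeak]
    grind

theorem Pref.leftDip_spec (δ : X) : LeftDip (Pref.rightPeak δ).reverse.strict δ :=
  ⟨(Pref.rightPeak_spec δ).1, fun x y h1 h2 => (Pref.rightPeak_spec δ).2 y x h2 h1⟩

theorem Pref.rightDip_spec (δ : X) : RightDip (Pref.leftPeak δ).reverse.strict δ :=
  ⟨(Pref.leftPeak_spec δ).1, fun x y h1 h2 => (Pref.leftPeak_spec δ).2 y x h2 h1⟩

/-- The admissible preferences of the public facility problem form a rich domain. -/
theorem richDomain_admissible {N : Type*} (X : Set ℝ) (A : Set N) :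
    RichDomain A fun i (t : Admissible X A i) => t.1.strict where
  asymm _ _ _ _ h1 h2 := h1.2 h2.1
  trans i t x y z h1 h2 :=
    ⟨t.1.transitive _ _ _ h1.1 h2.1, fun h => h1.2 (t.1.transitive _ _ _ h2.1 h)⟩
  total i t x y hxy := by
    by_contra! h
    simp only [Pref.strict_iff, not_not] at h
    exact hxy (t.1.antisymmetric _ _ h.2 h.1)
  peaked i hi t := t.2.1 hi
  dipped i hi t := t.2.2 hi
  rightPeak i hi ρ :=
    ⟨⟨Pref.rightPeak ρ, fun _ => ⟨ρ, (Pref.rightPeak_spec ρ).1⟩, fun h => absurd hi h⟩,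
      Pref.rightPeak_spec ρ⟩
  leftPeak i hi ρ :=
    ⟨⟨Pref.leftPeak ρ, fun _ => ⟨ρ, (Pref.leftPeak_spec ρ).1⟩, fun h => absurd hi h⟩,
      Pref.leftPeak_spec ρ⟩
  rightDip i hi δ :=
    ⟨⟨(Pref.leftPeak δ).reverse, fun h => absurd h hi, fun _ => ⟨δ, (Pref.rightDip_spec δ).1⟩⟩,
      Pref.rightDip_spec δ⟩
  leftDip i hi δ :=
    ⟨⟨(Pref.rightPeak δ).reverse, fun h => absurd h hi, fun _ => ⟨δ, (Pref.leftDip_spec δ).1⟩⟩,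
      Pref.leftDip_spec δ⟩

theorem nonempty_profile {N : Type*} (A : Set N) (x : X) : Nonempty (Profile X A) :=
  ⟨fun i =>
    if hi : i ∈ A then ((richDomain_admissible X A).rightPeak i hi x).choose
    else ((richDomain_admissible X A).rightDip i hi x).choose⟩

end Preferences

/-! ### The three statements for rules on `X` -/

section Rules

variable {N : Type*} {X : Set ℝ} {A : Set N} {f : Rule X A}

theorem StrategyProof.not_strict_update (hf : StrategyProof f) (R : Profile X A) (i : N)
    (t : Admissible X A i) : ¬ (R i).1.strict (f (Function.update R i t)) (f R) := by
  intro h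
  refine hf {i} (Set.ncard_singleton i) ⟨R, Function.update R i t, fun j hj => ?_, ?_⟩
  · exact Function.update_of_ne hj _ _
  · rintro j rfl
    exact h

theorem StrategyProof.groupStrategyProof [Finite N] (hf : StrategyProof f) :
    GroupStrategyProof (fun i (t : Admissible X A i) => t.1.strict) f :=
  (richDomain_admissible X A).groupStrategyProof hf.not_strict_update

theorem ParetoEfficient.efficient (hf : ParetoEfficient f) :
    Efficient (fun i (t : Admissible X A i) => t.1.strict) f := by
  intro R x
  by_contra! h
  exact hf R ⟨x, h⟩

theorem StrategyProof.paretoEfficient_of_omega_eq_univ [Finite N] [Nonempty N]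
    (hf : StrategyProof f) (hΩ : Omega f = Set.univ) : ParetoEfficient f := by
  rintro R ⟨x, hx⟩
  obtain ⟨R', rfl⟩ : x ∈ Omega f := hΩ ▸ Set.mem_univ x
  have hne : f R ≠ f R' := by
    intro heq
    obtain ⟨i⟩ := ‹Nonempty N›
    exact (hx i).2 (heq ▸ Pref.rel_refl _ _)
  obtain ⟨i, -, hi⟩ := hf.groupStrategyProof R R' hne
  exact hi.2 (hx i).1

theorem StrategyProof.omega_eq_of_paretoEfficient [Finite N] (hf : StrategyProof f)
    (hΩ : Omega f ≠ Set.univ) (hE : ParetoEfficient f) :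
    ∃ m M : X, IsBot m ∧ IsTop M ∧ Omega f = {m, M} := by
  obtain ⟨x, hx⟩ := (Set.ne_univ_iff_exists_notMem _).1 hΩ
  obtain ⟨R⟩ := nonempty_profile A x
  exact (richDomain_admissible X A).exists_range_eq hf.not_strict_update hE.efficient
    (fun R h => hx ⟨R, h⟩) R

variable {m M : X}

/-- Both extremes being attainable at the `A`-rankings of `R`, monotonicity excludes a dominated
choice of `m`, and of `M` by order reversal. -/
theorem StrategyProof.not_dominated_of_attained [Finite N] (hf : StrategyProof f)
    (hm : IsBot m) (hM : IsTop M) (hmM : m ≠ M) (hΩ : Omega f = {m, M})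
    (hatt : ∀ R : Profile X A, ∃ Rm RM : Profile X A, f Rm = m ∧ f RM = M ∧
      ∀ i ∈ A, ((Rm i).1.strict m M → (R i).1.strict m M) ∧
        ((RM i).1.strict M m → (R i).1.strict M m)) : ParetoEfficient f := by
  rintro R ⟨x, hx⟩
  have hrange : ∀ R, f R = m ∨ f R = M := fun R => hΩ.subset ⟨R, rfl⟩
  obtain ⟨Rm, RM, hRm, hRM, hA⟩ := hatt R
  have h := richDomain_admissible X A
  rcases hrange R with hR | hR
  · exact hf.groupStrategyProof.not_dominated h hm hM hmM hrange hRM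
      (fun i hi => (hA i hi).2) hR (hR ▸ hx)
  · exact hf.groupStrategyProof.not_dominated (α := Xᵒᵈ) h.dual hM hm hmM.symm
      (fun R => (hrange R).symm) hRm (fun i hi => (hA i hi).1) hR (hR ▸ hx)

theorem isRestrictedPeak_pair_left {R : Pref X} :
    IsRestrictedPeak {m, M} R m ↔ (m ≠ M → R.strict m M) := by
  constructor
  · exact fun h hne => h.2 M ⟨by simp, hne.symm⟩
  · refine fun h => ⟨by simp, ?_⟩
    rintro y ⟨rfl | rfl, hy⟩
    · exact absurd rfl hy
    · exact h (Ne.symm hy)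

theorem isRestrictedPeak_pair_right {R : Pref X} :
    IsRestrictedPeak {m, M} R M ↔ (m ≠ M → R.strict M m) := by
  rw [Set.pair_comm, isRestrictedPeak_pair_left, ne_comm]

theorem StrategyProof.paretoEfficient_of_rOmega_eq [Finite N] (hf : StrategyProof f)
    (hm : IsBot m) (hM : IsTop M) (hmM : m ≠ M) (hΩ : Omega f = {m, M})
    (hr : rOmega f = {{m, M}}) : ParetoEfficient f := by
  refine hf.not_dominated_of_attained hm hM hmM hΩ fun R => ?_
  have hmΩ : m ∈ Omega f := hΩ ▸ by simp
  have hMΩ : M ∈ Omega f := hΩ ▸ by simp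
  -- These are the restricted peaks of `R` itself, so profiles realising `p` rank `m` and `M` on `A`
  -- as `R` does.
  let p : A → Omega f := fun i => if (R i).1.strict M m then ⟨M, hMΩ⟩ else ⟨m, hmΩ⟩
  have hp : OmegaAt f p = {m, M} := by
    have : OmegaAt f p ∈ rOmega f := ⟨p, rfl⟩
    rwa [hr] at this
  obtain ⟨Rm, hRm, hfm⟩ : m ∈ OmegaAt f p := hp ▸ by simp
  obtain ⟨RM, hRM, hfM⟩ : M ∈ OmegaAt f p := hp ▸ by simp
  refine ⟨Rm, RM, hfm, hfM, fun i hi => ?_⟩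
  have h1 := hRm ⟨i, hi⟩
  have h2 := hRM ⟨i, hi⟩
  by_cases hs : (R i).1.strict M m
  · simp only [p, if_pos hs, hΩ, isRestrictedPeak_pair_right] at h1
    exact ⟨fun h => absurd h.1 (h1 hmM).2, fun _ => hs⟩
  · simp only [p, if_neg hs, hΩ, isRestrictedPeak_pair_left] at h2
    exact ⟨fun _ => (richDomain_admissible X A).of_not hmM.symm hs,
      fun h => absurd h.1 (h2 hmM).2⟩

theorem ParetoEfficient.omegaAt_eq (hE : ParetoEfficient f)
    (hm : IsBot m) (hM : IsTop M) (hΩ : Omega f = {m, M})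
    (hΩ' : Omega f ≠ Set.univ) (p : A → Omega f) : OmegaAt f p = {m, M} := by
  obtain ⟨x, hx⟩ := (Set.ne_univ_iff_exists_notMem _).1 hΩ'
  simp only [hΩ, Set.mem_insert_iff, Set.mem_singleton_iff, not_or] at hx
  have hrange : ∀ R, f R = m ∨ f R = M := fun R => hΩ.subset ⟨R, rfl⟩
  have h := richDomain_admissible X A
  have hpeak : ∀ R : Profile X A, (∀ i : A, ((p i).1 = M → (R i).1.strict M m) ∧
      ((p i).1 ≠ M → (R i).1.strict m M)) →
      ∀ i : A, IsRestrictedPeak (Omega f) (R i).1 (p i).1 := by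
    intro R hR i
    by_cases hpi : (p i).1 = M
    · rw [hpi, hΩ, isRestrictedPeak_pair_right]
      exact fun _ => (hR i).1 hpi
    · have hpm : (p i).1 = m := (hΩ.subset (p i).2).resolve_right hpi
      rw [hpm, hΩ, isRestrictedPeak_pair_left]
      exact fun _ => (hR i).2 hpi
  let B : Set N := {i | ∃ hi : i ∈ A, (p ⟨i, hi⟩).1 = M}
  have hB : ∀ i : A, i.1 ∈ B ↔ (p i).1 = M := fun i => ⟨fun ⟨_, h⟩ => h, fun h => ⟨i.2, h⟩⟩
  obtain ⟨Rm, hRm, hm'⟩ := hE.efficient.exists_eq_bot h hm hM hx.1 hx.2 hrange B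
  obtain ⟨RM, hRM, hM'⟩ := hE.efficient.exists_eq_bot (α := Xᵒᵈ) h.dual hM hm hx.2 hx.1
    (fun R => (hrange R).symm) Bᶜ
  refine Set.Subset.antisymm ?_ (Set.pair_subset ?_ ?_)
  · rintro _ ⟨R, -, rfl⟩
    exact hrange R
  · refine ⟨Rm, hpeak Rm fun i => ?_, hRm⟩
    have := hm' i i.2
    rwa [hB i] at this
  · refine ⟨RM, hpeak RM fun i => ?_, hRM⟩
    have := hM' i i.2
    rw [Set.mem_compl_iff, not_not, hB i] at this
    exact this.symm

theorem StrategyProof.paretoEfficient_iff [Finite N] (hf : StrategyProof f)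
    (hm : IsBot m) (hM : IsTop M) (hΩ : Omega f = {m, M}) (hΩ' : Omega f ≠ Set.univ) :
    ParetoEfficient f ↔ A = ∅ ∨ rOmega f = {{m, M}} := by
  have hmM : m ≠ M := by
    rintro rfl
    refine hΩ' (Set.eq_univ_of_forall fun x => ?_)
    rw [hΩ]
    exact .inl (le_antisymm (hM x) (hm x))
  have hmΩ : m ∈ Omega f := hΩ ▸ by simp
  have hMΩ : M ∈ Omega f := hΩ ▸ by simp
  constructor
  · intro hE
    have hall := hE.omegaAt_eq hm hM hΩ hΩ'
    -- The second alternative holds even for `A = ∅`, where the only `p` is the empty vector.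
    refine .inr (Set.eq_singleton_iff_unique_mem.2 ⟨⟨fun _ => ⟨m, hmΩ⟩, hall _⟩, ?_⟩)
    rintro _ ⟨p, rfl⟩
    exact hall p
  · rintro (rfl | hr)
    · obtain ⟨Rm, hRm⟩ := hmΩ
      obtain ⟨RM, hRM⟩ := hMΩ
      exact hf.not_dominated_of_attained hm hM hmM hΩ fun R =>
        ⟨Rm, RM, hRm, hRM, fun i hi => absurd hi (Set.notMem_empty i)⟩
    · exact hf.paretoEfficient_of_rOmega_eq hm hM hmM hΩ hr

end Rules

end PublicFacility

theorem proposition5 {N : Type*} [Finite N] [Nonempty N] (X : Set ℝ) (hX : X.Countable)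
    (A : Set N) (f : PublicFacility.Rule X A) (hf : PublicFacility.StrategyProof f) :
    (PublicFacility.Omega f = Set.univ → PublicFacility.ParetoEfficient f) ∧
    (PublicFacility.Omega f ≠ Set.univ →
      (¬ ∃ m M : X, IsBot m ∧ IsTop M ∧ PublicFacility.Omega f = {m, M}) →
      ¬ PublicFacility.ParetoEfficient f) ∧
    (∀ m M : X, IsBot m → IsTop M →
      PublicFacility.Omega f = {m, M} → PublicFacility.Omega f ≠ Set.univ →
      (PublicFacility.ParetoEfficient f ↔
        A = ∅ ∨ PublicFacility.rOmega f = {{m, M}})) := by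
  exact ⟨hf.paretoEfficient_of_omega_eq_univ,
    fun hΩ hne hE => hne (hf.omega_eq_of_paretoEfficient hΩ hE),
    fun m M hm hM hΩ hΩ' => hf.paretoEfficient_iff hm hM hΩ hΩ'⟩
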